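/- Let $G=(V,E_{\to},E_{\leftrightarrow})$ be a finite mixed graph: $E_{\to}$ is a set of ordered pairs $j\to k$ of distinct nodes, and $E_{\leftrightarrow}$ is a set of unordered pairs $j\leftrightarrow k$ of distinct nodes. Write $\mathrm{pa}(i)=\{j: j\to i\in E_{\to}\}$ and $\mathrm{sib}(i)=\{j: j\leftrightarrow i\in E_{\leftrightarrow}\}$, and let $G_{-i}$ be the subgraph of $G$ induced on $V\setminus\{i\}$. Let $\mathbf{B}(G)$ be the set of real $V\times V$ matrices $B=(\beta_{jk})$ with $I-B$ invertible and $\beta_{jk}=0$ whenever $k\to j\notin E_{\to}$, and let $\mathbf{\Omega}(G)$ be the set of positive definite symmetric real $V\times V$ matrices $\Omega=(\omega_{jk})$ with $\omega_{jk}=0$ whenever $j\ne k$ and $j\leftrightarrow k\notin E_{\leftrightarrow}$. Let $N\ge |V|$. For $i\in V$ and $(Y,B,\Omega)\in\mathbb{R}^{V\times N}\times\mathbf{B}(G)\times\mathbf{\Omega}(G)$, put $Z_{-i}=(\Omega_{-i,-i})^{-1}(I-B)_{-i}Y$, where $(I-B)_{-i}$ is $I-B$ without its $i$-th row and $\Omega_{-i,-i}$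 is $\Omega$ without its $i$-th row and column. Condition $(\mathrm{A1})_i$ says that the matrix $$\begin{pmatrix} Z_{\mathrm{sib}(i)}\\ Y_{\mathrm{pa}(i)\cup\{i\}}\end{pmatrix}\in\mathbb{R}^{(|\mathrm{sib}(i)|+|\mathrm{pa}(i)|+1)\times N}$$ has linearly independent rows. A property holds for generic triples $(Y,B,\Omega)$ if the triples in $\mathbb{R}^{V\times N}\times\mathbf{B}(G)\times\mathbf{\Omega}(G)$ that violate it lie in the zero set of a nonzero real polynomial in the free coordinates, that is, in the entries of $Y$, the $\beta_{kj}$ with $j\to k\in E_{\to}$, the $\omega_{jj}$ with $j\in V$, and the $\omega_{jk}$ with $j\leftrightarrow k\in E_{\leftrightarrow}$. A half-collider path is a path $i_1,\dots,i_k$ ($k\ge 1$, nodes not necessarily distinct) such that either all its edges are bi-directed (possibly there are none), or its first edge is $i_1\to i_2$ and all other edges (possibly none) are bi-directed. Its bi-directed portion is $\{i_1,\dots,i_k\}$ in the first case and $\{i_2,\dots,i_k\}$ in the second. A system of half-collider paths from $S_b$ to $S_e$ is a collection of $s=|S_b|=|S_e|$ half-collider paths, each from a node in $S_b$ to a node in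 $S_e$, such that every node in $S_b$ is the first node of some path and every node in $S_e$ is the last node of some path. Then, for every $i\in V$, the following are equivalent: (a) Condition $(\mathrm{A1})_i$ holds for generic triples $(Y,B,\Omega)\in\mathbb{R}^{V\times N}\times\mathbf{B}(G)\times\mathbf{\Omega}(G)$. (b) The graph $G_{-i}$ contains a system of half-collider paths from a subset of $V\setminus(\mathrm{pa}(i)\cup\{i\})$ to $\mathrm{sib}(i)$ whose bi-directed portions are pairwise disjoint. The equivalence also holds if "generic" in (a) is read in the measure-theoretic sense, that is, if the set of triples violating $(\mathrm{A1})_i$ has Lebesgue measure zero in the space of free coordinates. -/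

import Mathlib

open MeasureTheory

/-- A mixed graph on the vertex set `V`: directed edges (ordered pairs, no self-loops)
and bi-directed edges (unordered pairs of distinct nodes). -/
structure MixedGraph (V : Type*) where
  /-- `dir j k` means `j → k`. -/
  dir : V → V → Prop
  dir_irrefl : ∀ j, ¬ dir j j
  /-- `bi.Adj j k` means `j ↔ k`. -/
  bi : SimpleGraph V

namespace MixedGraph

/-- The parents of `i`: all `j` with `j → i`. -/
def pa {V : Type*} (G : MixedGraph V) (i : V) : Set V := {j | G.dir j i}

/-- The siblings of `i`: all `j` with `j ↔ i`. -/
def sib {V : Type*} (G : MixedGraph V) (i : V) : Set V := {j | G.bi.Adj j i}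

theorem ne_of_mem_sib {V : Type*} (G : MixedGraph V) {i j : V} (h : j ∈ G.sib i) : j ≠ i :=
  SimpleGraph.Adj.ne h

/-- The induced subgraph `G_{-i}` on `V ∖ {i}`. -/
def remove {V : Type*} (G : MixedGraph V) (i : V) : MixedGraph {j : V // j ≠ i} where
  dir j k := G.dir j k
  dir_irrefl j := G.dir_irrefl j
  bi := G.bi.comap Subtype.val

/-! ### Half-collider paths -/

/-- A half-collider path from `a` to `b`: either all of its edges are bi-directed (possibly there
is no edge at all), or its first edge is directed, pointing away from `a`, and all other edges
(possibly none) are bi-directed. Vertices may repeat. -/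
inductive HalfColliderPath {V : Type*} (G : MixedGraph V) : V → V → Type _
  | bidirected {a b : V} (p : G.bi.Walk a b) : HalfColliderPath G a b
  | directed {a m b : V} (h : G.dir a m) (p : G.bi.Walk m b) : HalfColliderPath G a b

/-- The bi-directed portion: all nodes of the path, except that the initial occurrence of the tail
of a directed first edge is not counted. -/
def HalfColliderPath.portion {V : Type*} {G : MixedGraph V} {a b : V} :
    G.HalfColliderPath a b → Set V
  | .bidirected p => {v | v ∈ p.support}
  | .directed _ p => {v | v ∈ p.support}

/-- A system of `s` half-collider paths from `Sb` to `Se`. -/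
structure HalfColliderSystem {V : Type*} (G : MixedGraph V) (Sb Se : Set V) (s : ℕ) where
  first : Fin s → V
  last : Fin s → V
  path : ∀ l, G.HalfColliderPath (first l) (last l)
  ncard_begin : Sb.ncard = s
  ncard_end : Se.ncard = s
  first_mem : ∀ l, first l ∈ Sb
  last_mem : ∀ l, last l ∈ Se
  exists_first : ∀ v ∈ Sb, ∃ l, first l = v
  exists_last : ∀ v ∈ Se, ∃ l, last l = v

/-- The bi-directed portions of the paths of the system are pairwise disjoint. -/
def HalfColliderSystem.DisjointPortions {V : Type*} {G : MixedGraph V} {Sb Se : Set V} {s : ℕ}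
    (P : G.HalfColliderSystem Sb Se s) : Prop :=
  ∀ l m : Fin s, l ≠ m → Disjoint (P.path l).portion (P.path m).portion

/-- `G_{-i}` contains a system of half-collider paths from a subset of `V ∖ (pa(i) ∪ {i})` to
`sib(i)` with pairwise disjoint bi-directed portions. The parents and siblings of `i` are those
in `G`; since the vertices of `G_{-i}` differ from `i`, the starting set avoids `i`. -/
def HalfColliderCriterion {V : Type*} (G : MixedGraph V) (i : V) : Prop :=
  ∃ (Sb : Set {j : V // j ≠ i}) (s : ℕ)
    (P : (G.remove i).HalfColliderSystem Sb {j | (j : V) ∈ G.sib i} s),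
    (∀ j ∈ Sb, (j : V) ∉ G.pa i) ∧ P.DisjointPortions

/-! ### Parameter matrices and the condition on the block update -/

/-- The set `𝐁(G)`; the entry `β_{jk}` belongs to the edge `k → j`. -/
def BSet {V : Type*} [Fintype V] [DecidableEq V] (G : MixedGraph V) : Set (Matrix V V ℝ) :=
  {B | IsUnit (1 - B) ∧ ∀ j k, ¬ G.dir k j → B j k = 0}

/-- The set `𝛀(G)` of positive definite symmetric matrices supported on the diagonal and on the
bi-directed edges. -/
def OmegaSet {V : Type*} [Fintype V] [DecidableEq V] (G : MixedGraph V) : Set (Matrix V V ℝ) :=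
  {Ω | Ω.PosDef ∧ ∀ j k, j ≠ k → ¬ G.bi.Adj j k → Ω j k = 0}

/-- The pseudo-variables `Z_{-i} = (Ω_{-i,-i})⁻¹ (I - B)_{-i} Y`. -/
noncomputable def pseudoVariables {V : Type*} [Fintype V] [DecidableEq V] {N : ℕ} (i : V)
    (Y : Matrix V (Fin N) ℝ) (B Ω : Matrix V V ℝ) : Matrix {j : V // j ≠ i} (Fin N) ℝ :=
  (Ω.submatrix (Subtype.val : {j : V // j ≠ i} → V) (Subtype.val : {j : V // j ≠ i} → V))⁻¹ *
    (((1 : Matrix V V ℝ) - B).submatrix (Subtype.val : {j : V // j ≠ i} → V) id * Y)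

/-- The matrix with the rows `Z_{sib(i)}` stacked on top of the rows `Y_{pa(i) ∪ {i}}`. -/
noncomputable def stackedMatrix {V : Type*} [Fintype V] [DecidableEq V] {N : ℕ} (G : MixedGraph V)
    (i : V) (Y : Matrix V (Fin N) ℝ) (B Ω : Matrix V V ℝ) :
    Matrix (G.sib i ⊕ ↥(G.pa i ∪ {i})) (Fin N) ℝ :=
  Matrix.of (Sum.elim (fun k => pseudoVariables i Y B Ω ⟨k, G.ne_of_mem_sib k.2⟩) (fun k => Y k))

/-- Condition `(A1)_i`: the stacked matrix has linearly independent rows. -/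
def CondA1 {V : Type*} [Fintype V] [DecidableEq V] {N : ℕ} (G : MixedGraph V)
    (i : V) (Y : Matrix V (Fin N) ℝ) (B Ω : Matrix V V ℝ) : Prop :=
  LinearIndependent ℝ (G.stackedMatrix i Y B Ω).row

/-! ### Genericity -/

/-- The free coordinates of a triple `(Y, B, Ω)`. -/
inductive Coord {V : Type*} (G : MixedGraph V) (N : ℕ) : Type _
  /-- the entry of `Y` in row `j` and column `n` -/
  | data (j : V) (n : Fin N) : Coord G N
  /-- the coefficient `β_{kj}` of the directed edge `j → k` -/
  | coeff (j k : V) (h : G.dir j k) : Coord G N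
  /-- the diagonal entry `ω_{jj}` -/
  | var (j : V) : Coord G N
  /-- the entry `ω_{jk} = ω_{kj}` of the bi-directed edge `{j, k}` -/
  | cov (e : G.bi.edgeSet) : Coord G N

instance {V : Type*} [Finite V] (G : MixedGraph V) (N : ℕ) : Finite (G.Coord N) := by
  let f : G.Coord N → (V × Fin N) ⊕ (V × V) ⊕ V ⊕ Sym2 V := fun c => match c with
    | .data j n => .inl (j, n)
    | .coeff j k _ => .inr (.inl (j, k))
    | .var j => .inr (.inr (.inl j))
    | .cov e => .inr (.inr (.inr e.1))
  have hf : Function.Injective f := by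
    intro c d h
    cases c <;> cases d <;> simp_all [f, Subtype.ext_iff]
  have : Finite (Sym2 V) := Quot.finite _
  exact Finite.of_injective f hf

noncomputable instance {V : Type*} [Finite V] (G : MixedGraph V) (N : ℕ) :
    Fintype (G.Coord N) := Fintype.ofFinite _

/-- The data matrix with coordinates `θ`. -/
def Coord.toY {V : Type*} {G : MixedGraph V} {N : ℕ} (θ : G.Coord N → ℝ) : Matrix V (Fin N) ℝ :=
  Matrix.of fun j n => θ (.data j n)

open Classical in
/-- The coefficient matrix with coordinates `θ`. -/
noncomputable def Coord.toB {V : Type*} {G : MixedGraph V} {N : ℕ} (θ : G.Coord N → ℝ) :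
    Matrix V V ℝ :=
  Matrix.of fun k j => if h : G.dir j k then θ (.coeff j k h) else 0

open Classical in
/-- The symmetric matrix with coordinates `θ`. -/
noncomputable def Coord.toOmega {V : Type*} {G : MixedGraph V} {N : ℕ} (θ : G.Coord N → ℝ) :
    Matrix V V ℝ :=
  Matrix.of fun j k =>
    if j = k then θ (.var j) else if h : s(j, k) ∈ G.bi.edgeSet then θ (.cov ⟨s(j, k), h⟩) else 0

/-- The coordinate vectors of those triples in `ℝ^{V × N} × 𝐁(G) × 𝛀(G)` that fail to have
the property `P`. -/
def exceptionalSet {V : Type*} [Fintype V] [DecidableEq V] (G : MixedGraph V) (N : ℕ)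
    (P : Matrix V (Fin N) ℝ → Matrix V V ℝ → Matrix V V ℝ → Prop) : Set (G.Coord N → ℝ) :=
  {θ | Coord.toB θ ∈ G.BSet ∧ Coord.toOmega θ ∈ G.OmegaSet ∧
    ¬ P (Coord.toY θ) (Coord.toB θ) (Coord.toOmega θ)}

/-- `P` holds for generic triples in the algebraic sense: the exceptional set is contained in the
zero set of a nonzero polynomial in the free coordinates. -/
def HoldsGenerically {V : Type*} [Fintype V] [DecidableEq V] (G : MixedGraph V) (N : ℕ)
    (P : Matrix V (Fin N) ℝ → Matrix V V ℝ → Matrix V V ℝ → Prop) : Prop :=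
  ∃ f : MvPolynomial (G.Coord N) ℝ, f ≠ 0 ∧
    ∀ θ ∈ G.exceptionalSet N P, MvPolynomial.eval θ f = 0

/-- `P` holds for generic triples in the measure-theoretic sense: the exceptional set has Lebesgue
measure zero in the space of free coordinates. -/
def HoldsAlmostEverywhere {V : Type*} [Fintype V] [DecidableEq V] (G : MixedGraph V) (N : ℕ)
    (P : Matrix V (Fin N) ℝ → Matrix V V ℝ → Matrix V V ℝ → Prop) : Prop :=
  volume (G.exceptionalSet N P) = 0

end MixedGraph

/-!
Since `Y_{pa(i) ∪ {i}}` are rows of `Y`, the stacked matrix is `S * Y` with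
`S = [Ω_{-i,-i}⁻¹ (I - B)_{-i} on the rows sib(i); unit rows of pa(i) ∪ {i}]`, so for `N` large
`(A1)_i` can be met by some `Y` iff the rows `sib(i)` of `Ω_{-i,-i}⁻¹ (I - B)_{-i,-i}` stay
independent on the columns outside `pa(i) ∪ {i}`, i.e. iff some minor of that matrix is nonzero.

A nonzero minor of `Ω⁻¹ (I - B)` with rows `e` and columns `f` is a Schur complement of the matrix
with blocks `Ω`, `(I - B)_{·, f}`, `I_{e, ·}`, `0`. A nonzero term of the Leibniz expansion of its
determinant is a permutation which sends the extra index `s` to the node `e s`, moves along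
bi-directed edges or stays put, and leaves the nodes through `I - B`; its first-return orbits to the
extra indices are half-collider paths with disjoint bi-directed portions, read backwards.

Conversely, let `Ω = I + L` with `L` the Laplacian of the union of the bi-directed portions of a
disjoint system. By the minimum principle `Ω⁻¹` is positive between nodes joined by a walk, and it
vanishes between different portions. Giving the directed first edges a common large weight makes the
minor of `Ω⁻¹ (I - B)` column diagonally dominant, hence nonzero.

The Gram determinant of the stacked matrix, with the adjugate in place of the inverse of
`Ω_{-i,-i}`, is a polynomial in the free coordinates whose nonvanishing is `(A1)_i`. Zero sets of
nonzero polynomials are null, while the admissible parameters contain an open set, so the two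
readings of genericity agree.
-/

/-! ### Zero sets of polynomials and positive definite matrices -/

theorem measure_pi_setOf_eval_eq_zero_fin {n : ℕ} (μ : Fin n → Measure ℝ)
    [∀ j, SigmaFinite (μ j)] [∀ j, NullSingletonClass (μ j)] {f : MvPolynomial (Fin n) ℝ}
    (hf : f ≠ 0) :
    Measure.pi μ {x | MvPolynomial.eval x f = 0} = 0 := by
  induction n with
  | zero =>
    convert measure_empty (μ := Measure.pi μ)
    refine Set.eq_empty_of_forall_notMem fun x hx => hf (MvPolynomial.funext fun y => ?_)
    rw [Subsingleton.elim y x, map_zero]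
    exact hx
  | succ n ih =>
    let q := MvPolynomial.finSuccEquiv ℝ n f
    have hq : q.leadingCoeff ≠ 0 := by simpa [q] using hf
    have hcons := (measurePreserving_piFinSuccAbove μ 0).symm.comp
      (Measure.measurePreserving_swap (μ := Measure.pi fun j => μ (Fin.succAbove 0 j)) (ν := μ 0))
    have hmeas : MeasurableSet {x : Fin (n + 1) → ℝ | MvPolynomial.eval x f = 0} :=
      (isClosed_singleton.preimage (MvPolynomial.continuous_eval f)).measurableSet
    rw [← hcons.measure_preimage hmeas.nullMeasurableSet,
      Measure.measure_prod_null (hcons.measurable hmeas)]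
    filter_upwards [measure_eq_zero_iff_ae_notMem.1 (ih (fun j => μ (Fin.succAbove 0 j)) hq)]
      with s hs
    -- Almost every slice keeps the leading coefficient of `q`, hence has only finitely many zeros.
    have hslice : q.map (MvPolynomial.eval s) ≠ 0 := fun h =>
      hs (by simpa using congrArg (Polynomial.coeff · q.natDegree) h)
    refine ((Polynomial.finite_setOfPred_isRoot hslice).subset fun y hy => ?_).measure_zero _
    have hy : MvPolynomial.eval (Fin.cons y s : Fin (n + 1) → ℝ) f = 0 := by
      simpa [MeasurableEquiv.piFinSuccAbove, Fin.consEquiv] using hy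
    rwa [MvPolynomial.eval_eq_eval_mv_eval'] at hy

theorem measure_pi_setOf_eval_eq_zero {σ : Type*} [Fintype σ] (μ : σ → Measure ℝ)
    [∀ j, SigmaFinite (μ j)] [∀ j, NullSingletonClass (μ j)] {f : MvPolynomial σ ℝ} (hf : f ≠ 0) :
    Measure.pi μ {x | MvPolynomial.eval x f = 0} = 0 := by
  let e := Fintype.equivFin σ
  have hmeas : MeasurableSet {x : σ → ℝ | MvPolynomial.eval x f = 0} :=
    (isClosed_singleton.preimage (MvPolynomial.continuous_eval f)).measurableSet
  rw [← (measurePreserving_piCongrLeft μ e.symm).measure_preimage hmeas.nullMeasurableSet]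
  have hrename : MvPolynomial.rename e f ≠ 0 := by
    simpa using (MvPolynomial.rename_injective e e.injective).ne hf
  convert measure_pi_setOf_eval_eq_zero_fin (fun j => μ (e.symm j)) hrename using 2
  ext x
  have hx : MeasurableEquiv.piCongrLeft (fun _ => ℝ) e.symm x = x ∘ e := by
    ext j
    obtain ⟨k, rfl⟩ := e.symm.surjective j
    simp [MeasurableEquiv.coe_piCongrLeft, Equiv.piCongrLeft_apply_apply]
  simp only [Set.mem_preimage, Set.mem_ofPred_eq, MvPolynomial.eval_rename, hx]

open Filter Topology Matrix in
theorem eventually_posDef_of_isHermitian {n : Type*} [Finite n] {A : Matrix n n ℝ}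
    (hA : A.PosDef) : ∀ᶠ M in 𝓝 A, M.IsHermitian → M.PosDef := by
  have := Fintype.ofFinite n
  have hsphere : ∀ᶠ M in 𝓝 A, ∀ x ∈ Metric.sphere (0 : n → ℝ) 1, 0 < x ⬝ᵥ M *ᵥ x := by
    refine (isCompact_sphere _ _).eventually_forall_of_forall_eventually fun x hx => ?_
    have hcont : Continuous fun p : Matrix n n ℝ × (n → ℝ) => p.2 ⬝ᵥ p.1 *ᵥ p.2 := by fun_prop
    refine (isOpen_lt continuous_const hcont).mem_nhds ?_
    simpa using hA.dotProduct_mulVec_pos (ne_zero_of_mem_unit_sphere ⟨x, hx⟩)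
  filter_upwards [hsphere] with M hM hM'
  refine .of_dotProduct_mulVec_pos hM' fun x hx => ?_
  have h := hM (‖x‖⁻¹ • x) (by simp [norm_smul, hx])
  rw [mulVec_smul, dotProduct_smul, smul_dotProduct, smul_eq_mul, smul_eq_mul, ← mul_assoc] at h
  simpa using pos_of_mul_pos_right h (by positivity)

/-! ### Minors and linear independence of rows -/

section LinearAlgebra

open Matrix

variable {m n p κ R K : Type*} [CommRing R] [Field K]

theorem linearIndependent_row_of_mul [Fintype n] {A : Matrix m n R} {B : Matrix n p R}
    (h : LinearIndependent R (A * B).row) : LinearIndependent R A.row :=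
  .of_comp B.vecMulLinear h

theorem linearIndependent_row_of_det_submatrix_ne_zero [IsDomain R] [Fintype κ] [DecidableEq κ]
    {A : Matrix m n R} (e : κ ≃ m) (f : κ → n) (h : (A.submatrix e f).det ≠ 0) :
    LinearIndependent R A.row := by
  rw [← linearIndependent_equiv e]
  exact (linearIndependent_rows_of_det_ne_zero h).of_comp (LinearMap.funLeft R R f)

theorem injective_of_det_submatrix_ne_zero [Fintype κ] [DecidableEq κ] {A : Matrix m n R}
    {e : κ → m} {f : κ → n} (h : (A.submatrix e f).det ≠ 0) :
    Function.Injective e ∧ Function.Injective f := by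
  constructor <;> intro a b hab <;> by_contra hne
  · exact h (det_zero_of_row_eq hne (funext fun c => by simp [hab]))
  · exact h (det_zero_of_column_eq hne fun c => by simp [hab])

theorem exists_det_submatrix_ne_zero [Fintype m] [DecidableEq m] [Finite n] {A : Matrix m n K}
    (hA : LinearIndependent K A.row) : ∃ f : m → n, (A.submatrix id f).det ≠ 0 := by
  have := Fintype.ofFinite n
  obtain ⟨κ, a, ha, hspan, hindep⟩ := exists_linearIndependent' K A.col
  have : Fintype κ := .ofInjective a ha
  have hcard : Fintype.card m = Fintype.card κ := by
    rw [← hA.rank_matrix, rank_eq_finrank_span_cols, ← hspan, finrank_span_eq_card hindep]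
  let e := Fintype.equivOfCardEq hcard
  refine ⟨a ∘ e, IsUnit.ne_zero ?_⟩
  rw [← isUnit_iff_isUnit_det, ← linearIndependent_cols_iff_isUnit]
  exact hindep.comp e e.injective

theorem exists_linearIndependent_row_mul [Fintype m] [Fintype n] [Fintype p] {A : Matrix m n K}
    (hA : LinearIndependent K A.row) (hcard : Fintype.card m ≤ Fintype.card p) :
    ∃ Y : Matrix n p K, LinearIndependent K (A * Y).row := by
  classical
  obtain ⟨a⟩ := Function.Embedding.nonempty_of_card_le hcard
  obtain ⟨B, hB⟩ : ∃ B : Matrix n m K, A * B = 1 := by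
    obtain ⟨f, hf⟩ := exists_det_submatrix_ne_zero hA
    refine ⟨(1 : Matrix n n K).submatrix id f * (A.submatrix id f)⁻¹, ?_⟩
    have hcols : A * (1 : Matrix n n K).submatrix id f = A.submatrix id f := by
      simpa using (submatrix_mul A (1 : Matrix n n K) id id f Function.bijective_id).symm
    rw [← Matrix.mul_assoc, hcols, mul_nonsing_inv _ hf.isUnit]
  refine ⟨B * (1 : Matrix p p K).submatrix a id, ?_⟩
  rw [← Matrix.mul_assoc, hB, Matrix.one_mul]
  exact (linearIndependent_rows_iff_isUnit.2 isUnit_one).comp a a.injective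

theorem linearIndependent_row_fromRows_one_submatrix_iff [Finite m] [DecidableEq n]
    (A : Matrix m n R) (Q : Set n) [Finite Q] :
    LinearIndependent R
        (fromRows A ((1 : Matrix n n R).submatrix (Subtype.val : Q → n) id)).row ↔
      LinearIndependent R (A.submatrix id (Subtype.val : ↥Qᶜ → n)).row := by
  have := Fintype.ofFinite m
  have := Fintype.ofFinite Q
  let E := (1 : Matrix n n R).submatrix (Subtype.val : Q → n) id
  have hE : ∀ (y : Q → R) (q : Q), (y ᵥ* E) q = y q := fun y q => by
    simp [E, vecMul, dotProduct, one_apply, Subtype.val_inj]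
  have hEcompl : ∀ (y : Q → R), ∀ v ∉ Q, (y ᵥ* E) v = 0 := fun y v hv =>
    Finset.sum_eq_zero fun q _ =>
      mul_eq_zero_of_right _ (one_apply_ne (ne_of_mem_of_not_mem q.2 hv))
  rw [← vecMul_injective_iff, ← vecMul_injective_iff, ← coe_vecMulLinear, ← coe_vecMulLinear,
    injective_iff_map_eq_zero, injective_iff_map_eq_zero]
  simp only [coe_vecMulLinear, vecMul_fromRows]
  constructor
  · intro h x hx
    have hzero : x ᵥ* A + (fun q : Q => -(x ᵥ* A) q) ᵥ* E = 0 := by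
      ext v
      by_cases hv : v ∈ Q
      · rw [Pi.add_apply, hE _ ⟨v, hv⟩, add_neg_cancel, Pi.zero_apply]
      · rw [Pi.add_apply, hEcompl _ v hv, add_zero]
        exact congrFun hx ⟨v, hv⟩
    exact congrArg (· ∘ Sum.inl) (h (Sum.elim x fun q => -(x ᵥ* A) q) hzero)
  · intro h w hw
    have hleft : w ∘ Sum.inl = 0 := h _ <| by
      ext v
      have hv := congrFun hw v
      rwa [Pi.add_apply, hEcompl _ v v.2, add_zero] at hv
    have hright : w ∘ Sum.inr = 0 := by
      ext q
      have hq := congrFun hw q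
      rwa [hleft, zero_vecMul, zero_add, hE] at hq
    exact funext (Sum.rec (congrFun hleft) (congrFun hright))

theorem det_mul_transpose_self_ne_zero_iff [LinearOrder K] [IsStrictOrderedRing K] [Fintype m]
    [DecidableEq m] [Fintype n] {A : Matrix m n K} :
    (A * Aᵀ).det ≠ 0 ↔ LinearIndependent K A.row := by
  rw [← isUnit_iff_ne_zero, ← isUnit_iff_isUnit_det, ← linearIndependent_rows_iff_isUnit,
    linearIndependent_iff_card_eq_finrank_span, linearIndependent_iff_card_eq_finrank_span,
    Set.finrank, Set.finrank,
    ← rank_eq_finrank_span_row, ← rank_eq_finrank_span_row, rank_self_mul_transpose]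

theorem exists_perm_forall_apply_ne_zero [Fintype m] [DecidableEq m] {A : Matrix m m R}
    (hA : A.det ≠ 0) : ∃ σ : Equiv.Perm m, ∀ x, A x (σ x) ≠ 0 := by
  rw [← det_transpose, det_apply] at hA
  obtain ⟨σ, -, hσ⟩ := Finset.exists_ne_zero_of_sum_ne_zero hA
  refine ⟨σ, fun x hx => hσ ?_⟩
  rw [Finset.prod_eq_zero (Finset.mem_univ x) (by simpa using hx), smul_zero]

theorem inv_apply_eq_zero_of_mem_of_notMem [Fintype m] [DecidableEq m] {A : Matrix m m R}
    (hA : IsUnit A.det) {S : Set m} (hS : ∀ u ∈ S, ∀ v ∉ S, A u v = 0) {u v : m} (hu : u ∈ S)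
    (hv : v ∉ S) : A⁻¹ u v = 0 := by
  classical
  let _ := invertibleOfIsUnitDet A hA
  have hlt : ∀ {u v}, (v ∈ S) < (u ∈ S) ↔ u ∈ S ∧ v ∉ S := by
    simp only [lt_iff_le_not_ge, le_Prop_eq]
    tauto
  have hA' : A.BlockTriangular (· ∈ S) := fun u v h => hS u (hlt.1 h).1 v (hlt.1 h).2
  exact blockTriangular_inv_of_blockTriangular hA' (hlt.2 ⟨hu, hv⟩)

open Filter Bornology in
theorem exists_det_sub_smul_diagonal_ne_zero {𝕜 : Type*} [NontriviallyNormedField 𝕜] [Fintype m]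
    [DecidableEq m] {X : Matrix m m 𝕜} {d : m → 𝕜}
    (hX : ∀ j, d j = 0 → X j j ≠ 0 ∧ ∀ k ≠ j, X k j = 0) :
    ∃ c : 𝕜, (X - c • diagonal d).det ≠ 0 := by
  have hdom : ∀ᶠ c in cobounded 𝕜, ∀ j,
      ∑ k ∈ Finset.univ.erase j, ‖X k j‖ < ‖X j j - c * d j‖ := by
    refine eventually_all.2 fun j => ?_
    by_cases hj : d j = 0
    · obtain ⟨hdiag, hoff⟩ := hX j hj
      have hsum : ∑ k ∈ Finset.univ.erase j, ‖X k j‖ = 0 :=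
        Finset.sum_eq_zero fun k hk => by rw [hoff k (Finset.ne_of_mem_erase hk), norm_zero]
      refine .of_forall fun c => ?_
      rwa [hsum, hj, mul_zero, sub_zero, norm_pos_iff]
    · exact (tendsto_norm_cobounded_atTop.comp <| (tendsto_const_sub_cobounded (X j j)).comp <|
        tendsto_mul_right_cobounded hj).eventually_gt_atTop _
  -- For large `c` the matrix is strictly diagonally dominant by columns.
  obtain ⟨c, hc⟩ := hdom.exists
  refine ⟨c, det_ne_zero_of_sum_col_lt_diag fun j => ?_⟩
  have hoff : ∀ k ∈ Finset.univ.erase j, ‖(X - c • diagonal d) k j‖ = ‖X k j‖ := fun k hk => by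
    simp [Finset.ne_of_mem_erase hk]
  rw [Finset.sum_congr rfl hoff]
  simpa only [Matrix.sub_apply, Matrix.smul_apply, diagonal_apply_eq, smul_eq_mul] using hc j

end LinearAlgebra

/-! ### Inverses of shifted graph Laplacians -/

section Laplacian

open Matrix

variable {V : Type*} [Fintype V] [DecidableEq V] (H : SimpleGraph V) [DecidableRel H.Adj]

theorem posDef_one_add_lapMatrix : (1 + H.lapMatrix ℝ).PosDef :=
  PosDef.one.add_posSemidef (H.posSemidef_lapMatrix ℝ)

variable {H} {R : Type*} [CommRing R]

theorem one_add_lapMatrix_mulVec_apply (x : V → R) (u : V) :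
    ((1 + H.lapMatrix R) *ᵥ x) u = x u + ∑ w ∈ H.neighborFinset u, (x u - x w) := by
  rw [add_mulVec, one_mulVec, Pi.add_apply, H.lapMatrix_mulVec_apply, Finset.sum_sub_distrib,
    Finset.sum_const, H.card_neighborFinset_eq_degree, nsmul_eq_mul]

variable [LinearOrder R] [IsStrictOrderedRing R] {x : V → R}

theorem nonneg_of_one_add_lapMatrix_mulVec_nonneg (hx : 0 ≤ (1 + H.lapMatrix R) *ᵥ x) :
    0 ≤ x := by
  intro u
  have : Nonempty V := ⟨u⟩
  obtain ⟨v, hv⟩ := Finite.exists_min x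
  -- At a minimum of `x` the Laplacian contributes a nonpositive term.
  have hsum := Finset.sum_nonpos fun w (_ : w ∈ H.neighborFinset v) => sub_nonpos.2 (hv w)
  have hxv := hx v
  rw [one_add_lapMatrix_mulVec_apply] at hxv
  exact (hxv.trans (add_le_of_nonpos_right hsum)).trans (hv u)

theorem pos_of_one_add_lapMatrix_mulVec_pos (hx : 0 ≤ (1 + H.lapMatrix R) *ᵥ x) {u : V}
    (hu : 0 < ((1 + H.lapMatrix R) *ᵥ x) u) : 0 < x u := by
  have hnonneg := nonneg_of_one_add_lapMatrix_mulVec_nonneg hx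
  refine (hnonneg u).lt_of_ne' fun h => hu.not_ge ?_
  simpa [one_add_lapMatrix_mulVec_apply, h] using Finset.sum_nonneg fun w _ => hnonneg w

theorem pos_of_walk_of_one_add_lapMatrix_mulVec_nonneg (hx : 0 ≤ (1 + H.lapMatrix R) *ᵥ x)
    {u v : V} (p : H.Walk u v) (hv : 0 < x v) : 0 < x u := by
  have hnonneg := nonneg_of_one_add_lapMatrix_mulVec_nonneg hx
  induction p with
  | nil => exact hv
  | @cons u w _ hadj _ ih =>
    refine (hnonneg u).lt_of_ne' fun h => (ih hv).not_ge ?_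
    have hle := Finset.single_le_sum (fun w _ => hnonneg w) ((H.mem_neighborFinset u w).2 hadj)
    refine hle.trans ?_
    simpa [one_add_lapMatrix_mulVec_apply, h] using hx u

theorem inv_one_add_lapMatrix_pos {u v : V} (p : H.Walk u v) :
    0 < (1 + H.lapMatrix ℝ)⁻¹ u v := by
  have hcol : (1 + H.lapMatrix ℝ) *ᵥ ((1 + H.lapMatrix ℝ)⁻¹).col v = Pi.single v 1 := by
    rw [← mulVec_single_one, mulVec_mulVec,
      mul_nonsing_inv _ (posDef_one_add_lapMatrix H).det_pos.ne'.isUnit, one_mulVec]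
  have hnonneg : 0 ≤ (1 + H.lapMatrix ℝ) *ᵥ ((1 + H.lapMatrix ℝ)⁻¹).col v := by
    rw [hcol, Pi.single_nonneg]
    exact zero_le_one
  exact pos_of_walk_of_one_add_lapMatrix_mulVec_nonneg hnonneg p
    (pos_of_one_add_lapMatrix_mulVec_pos hnonneg (by simp [hcol]))

theorem exists_posDef_inv_diagonal_on_walks {ι : Type*} {G : SimpleGraph V} {t e : ι → V}
    (q : ∀ l, G.Walk (t l) (e l))
    (hq : Pairwise fun l m => Disjoint {v | v ∈ (q l).support} {v | v ∈ (q m).support}) :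
    ∃ Ω : Matrix V V ℝ, Ω.PosDef ∧ (∀ j k, j ≠ k → ¬ G.Adj j k → Ω j k = 0) ∧
      (∀ l, 0 < Ω⁻¹ (e l) (t l)) ∧ ∀ l m, l ≠ m → Ω⁻¹ (e l) (t m) = 0 := by
  classical
  let H : SimpleGraph V := ⨆ l, (q l).toSubgraph.spanningCoe
  have hH : ∀ {u v}, H.Adj u v ↔ ∃ l, s(u, v) ∈ (q l).edges := by
    simp [H, SimpleGraph.iSup_adj, SimpleGraph.Walk.adj_toSubgraph_iff_mem_edges]
  have hzero : ∀ u v, u ≠ v → ¬ H.Adj u v → (1 + H.lapMatrix ℝ) u v = 0 := fun u v huv hadj => by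
    simp [SimpleGraph.lapMatrix, SimpleGraph.degMatrix, SimpleGraph.adjMatrix_apply, huv, hadj]
  refine ⟨1 + H.lapMatrix ℝ, posDef_one_add_lapMatrix H, fun u v huv hadj => hzero u v huv ?_,
    fun l => ?_, fun l m hlm => ?_⟩
  · rw [hH]
    rintro ⟨l, hl⟩
    exact hadj ((q l).adj_of_mem_edges hl)
  · refine inv_one_add_lapMatrix_pos ((q l).transfer H fun a ha => ?_).reverse
    induction a with | h u v => exact hH.2 ⟨l, ha⟩
  · refine inv_apply_eq_zero_of_mem_of_notMem (posDef_one_add_lapMatrix H).det_pos.ne'.isUnit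
      (S := {v | v ∈ (q l).support}) (fun u hu v hv => hzero u v (ne_of_mem_of_not_mem hu hv) ?_)
      (q l).end_mem_support ((hq hlm).notMem_of_mem_right (q m).start_mem_support)
    rw [hH]
    rintro ⟨k, hk⟩
    obtain rfl : l = k := by
      by_contra hlk
      exact Set.disjoint_left.1 (hq hlk) hu ((q k).fst_mem_support_of_mem_edges hk)
    exact hv ((q l).snd_mem_support_of_mem_edges hk)

end Laplacian

/-! ### From nonzero minors to path systems -/

section FirstReturn

variable {α : Type*} (σ : Equiv.Perm α) (S : Set α)

/-- The first positive time at which the orbit of `x` under `σ` meets `S`. -/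
noncomputable def firstReturn (x : α) : ℕ := sInf {n | 0 < n ∧ (σ ^ n) x ∈ S}

variable {σ S} {x y : α}

theorem firstReturn_spec [Finite α] (hx : x ∈ S) :
    0 < firstReturn σ S x ∧ (σ ^ firstReturn σ S x) x ∈ S :=
  Nat.sInf_mem (s := {n | 0 < n ∧ (σ ^ n) x ∈ S})
    ⟨orderOf σ, orderOf_pos σ, by simpa [pow_orderOf_eq_one] using hx⟩

theorem pow_apply_notMem_of_lt_firstReturn {j : ℕ} (hj : 0 < j) (h : j < firstReturn σ S x) :
    (σ ^ j) x ∉ S :=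
  fun hmem => Nat.notMem_of_lt_sInf h ⟨hj, hmem⟩

theorem eq_of_pow_apply_eq_of_le_firstReturn (hx : x ∈ S) (hy : y ∈ S) {j k : ℕ} (hj : 0 < j)
    (hjx : j ≤ firstReturn σ S x) (hk : 0 < k) (hky : k ≤ firstReturn σ S y)
    (h : (σ ^ j) x = (σ ^ k) y) : x = y := by
  wlog hjk : j ≤ k generalizing x y j k
  · exact (this hy hx hk hky hj hjx h.symm (le_of_not_ge hjk)).symm
  obtain ⟨d, rfl⟩ := Nat.exists_eq_add_of_le hjk
  rw [pow_add, Equiv.Perm.mul_apply, EmbeddingLike.apply_eq_iff_eq] at h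
  obtain rfl | hd := d.eq_zero_or_pos
  · simpa using h
  · exact absurd (h ▸ hx) (pow_apply_notMem_of_lt_firstReturn hd (by lia))

end FirstReturn

theorem exists_walk_of_forall_eq_or_adj {V : Type*} {G : SimpleGraph V} {x : ℕ → V} {k : ℕ}
    (hx : ∀ j < k, x j = x (j + 1) ∨ G.Adj (x j) (x (j + 1))) :
    ∃ p : G.Walk (x k) (x 0), ∀ v ∈ p.support, ∃ j ≤ k, x j = v := by
  induction k with
  | zero => exact ⟨.nil, fun v hv => ⟨0, le_rfl, by simp_all⟩⟩
  | succ k ih =>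
    obtain ⟨p, hp⟩ := ih fun j hj => hx j (hj.trans k.lt_succ_self)
    have hp' : ∀ v ∈ p.support, ∃ j ≤ k + 1, x j = v := fun v hv => by
      obtain ⟨j, hj, rfl⟩ := hp v hv
      exact ⟨j, hj.trans k.le_succ, rfl⟩
    obtain heq | hadj := hx k k.lt_succ_self
    · rw [← heq]
      exact ⟨p, hp'⟩
    · exact ⟨.cons hadj.symm p, by simpa using ⟨⟨k + 1, le_rfl, rfl⟩, hp'⟩⟩

namespace MixedGraph

section Transversal

open Sum

theorem exists_halfColliderSystem {V ι : Type*} [Fintype ι] {G : MixedGraph V}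
    {first last : ι → V} (hfirst : Function.Injective first) (hlast : Function.Injective last)
    (path : ∀ k, G.HalfColliderPath (first k) (last k))
    (hpath : Pairwise fun k l => Disjoint (path k).portion (path l).portion) :
    ∃ P : G.HalfColliderSystem (Set.range first) (Set.range last) (Fintype.card ι),
      P.DisjointPortions := by
  let a := (Fintype.equivFin ι).symm
  have hcard : ∀ {g : ι → V}, Function.Injective g → (Set.range g).ncard = Fintype.card ι :=
    fun hg => by rw [← Set.image_univ, Set.ncard_image_of_injective _ hg, Set.ncard_univ,
      Nat.card_eq_fintype_card]
  exact ⟨{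
    first := first ∘ a
    last := last ∘ a
    path := fun l => path (a l)
    ncard_begin := hcard hfirst
    ncard_end := hcard hlast
    first_mem := fun _ => ⟨_, rfl⟩
    last_mem := fun _ => ⟨_, rfl⟩
    exists_first := fun _ ⟨k, hk⟩ => ⟨a.symm k, by simpa using hk⟩
    exists_last := fun _ ⟨k, hk⟩ => ⟨a.symm k, by simpa using hk⟩ },
    fun _ _ hlm => hpath (a.injective.ne hlm)⟩

variable {V ι : Type*} {G : MixedGraph V} {e f : ι → V} {σ : Equiv.Perm (V ⊕ ι)}

theorem exists_halfColliderPath_of_perm [Finite V] [Finite ι]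
    (hstart : ∀ s, σ (inr s) = inl (e s))
    (hbi : ∀ u v, σ (inl u) = inl v → u = v ∨ G.bi.Adj u v)
    (hdir : ∀ u t, σ (inl u) = inr t → f t = u ∨ G.dir (f t) u) (s : ι) :
    ∃ t, (σ ^ firstReturn σ (Set.range inr) (inr s)) (inr s) = inr t ∧
      ∃ p : G.HalfColliderPath (f t) (e s), ∀ v ∈ p.portion,
        ∃ j, 0 < j ∧ j ≤ firstReturn σ (Set.range inr) (inr s) ∧ (σ ^ j) (inr s) = inl v := by
  set r := firstReturn σ (Set.range inr) (inr s)
  obtain ⟨hr, t, ht⟩ : 0 < r ∧ (σ ^ r) (inr s) ∈ Set.range inr := firstReturn_spec ⟨s, rfl⟩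
  have : Nonempty V := ⟨e s⟩
  have hinl : ∀ j, j + 1 < r → ∃ u, (σ ^ (j + 1)) (inr s) = inl u := fun j hj => by
    rcases h : (σ ^ (j + 1)) (inr s) with u | t
    · exact ⟨u, rfl⟩
    · exact absurd ⟨t, h.symm⟩ (pow_apply_notMem_of_lt_firstReturn j.succ_pos hj)
  choose! x hx using hinl
  have hstep : ∀ j, (σ ^ (j + 1)) (inr s) = σ ((σ ^ j) (inr s)) := fun j => by
    rw [pow_succ', Equiv.Perm.mul_apply]
  obtain ⟨k, hk⟩ : ∃ k, r = k + 2 := by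
    refine Nat.exists_eq_add_of_le' (Nat.lt_of_le_of_ne hr fun h => ?_)
    rw [← h, pow_one, hstart] at ht
    exact inr_ne_inl ht
  have hx0 : x 0 = e s := inl_injective (by rw [← hx 0 (by lia), ← hstart, zero_add, pow_one])
  have hwalk := exists_walk_of_forall_eq_or_adj (G := G.bi) (x := x) (k := k) fun j hj =>
    hbi _ _ (by rw [← hx j (by lia), ← hx (j + 1) (by lia), hstep (j + 1)])
  rw [hx0] at hwalk
  obtain ⟨p, hp⟩ := hwalk
  have hsupport : ∀ v ∈ p.support, ∃ j, 0 < j ∧ j ≤ r ∧ (σ ^ j) (inr s) = inl v := fun v hv => by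
    obtain ⟨j, hj, rfl⟩ := hp v hv
    exact ⟨j + 1, j.succ_pos, by lia, hx j (by lia)⟩
  refine ⟨t, ht.symm, ?_⟩
  obtain heq | hadj := hdir (x k) t (by rw [← hx k (by lia), ht, hk, hstep (k + 1)])
  · rw [heq]
    exact ⟨.bidirected p, hsupport⟩
  · exact ⟨.directed hadj p, hsupport⟩

theorem exists_halfColliderSystem_of_perm [Finite V] [Fintype ι] (he : Function.Injective e)
    (hf : Function.Injective f) (hstart : ∀ s, σ (inr s) = inl (e s))
    (hbi : ∀ u v, σ (inl u) = inl v → u = v ∨ G.bi.Adj u v)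
    (hdir : ∀ u t, σ (inl u) = inr t → f t = u ∨ G.dir (f t) u) :
    ∃ P : G.HalfColliderSystem (Set.range f) (Set.range e) (Fintype.card ι),
      P.DisjointPortions := by
  have hmeet : ∀ {s s' : ι} {j j'}, 0 < j → j ≤ firstReturn σ (Set.range inr) (inr s) →
      0 < j' → j' ≤ firstReturn σ (Set.range inr) (inr s') →
      (σ ^ j) (inr s) = (σ ^ j') (inr s') → s = s' := fun hj hjr hj' hjr' h =>
    inr_injective (eq_of_pow_apply_eq_of_le_firstReturn (Set.mem_range_self _)
      (Set.mem_range_self _) hj hjr hj' hjr' h)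
  choose τ hτ p hp using exists_halfColliderPath_of_perm hstart hbi hdir
  have hpos : ∀ s : ι, 0 < firstReturn σ (Set.range inr) (inr s) := fun s =>
    (firstReturn_spec (Set.mem_range_self s)).1
  have hτinj : Function.Injective τ := fun s s' h =>
    hmeet (hpos s) le_rfl (hpos s') le_rfl (by rw [hτ, hτ, h])
  rw [← (Finite.surjective_of_injective hτinj).range_comp f]
  refine exists_halfColliderSystem (hf.comp hτinj) he p fun s s' hss' => ?_
  refine Set.disjoint_left.2 fun v hv hv' => hss' ?_
  obtain ⟨j, hj, hjr, h⟩ := hp s v hv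
  obtain ⟨j', hj', hjr', h'⟩ := hp s' v hv'
  exact hmeet hj hjr hj' hjr' (h.trans h'.symm)

theorem exists_halfColliderSystem_of_det_ne_zero {K : Type*} [Field K] [Fintype V] [DecidableEq V]
    [Fintype ι] [DecidableEq ι] {B Ω : Matrix V V K} (hB : ∀ j k, ¬ G.dir k j → B j k = 0)
    (hΩ : ∀ j k, j ≠ k → ¬ G.bi.Adj j k → Ω j k = 0) (hdet : Ω.det ≠ 0)
    (h : ((Ω⁻¹ * (1 - B)).submatrix e f).det ≠ 0) :
    ∃ P : G.HalfColliderSystem (Set.range f) (Set.range e) (Fintype.card ι),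
      P.DisjointPortions := by
  -- Up to sign and the factor `Ω.det`, the given minor is `M.det` by the Schur complement formula.
  let M := Matrix.fromBlocks Ω ((1 - B).submatrix id f) ((1 : Matrix V V K).submatrix e id) 0
  have hM : M.det ≠ 0 := by
    let _ := Matrix.invertibleOfIsUnitDet Ω hdet.isUnit
    have hschur : (1 : Matrix V V K).submatrix e id * ⅟Ω * (1 - B).submatrix id f =
        (Ω⁻¹ * (1 - B)).submatrix e f := by
      ext a b
      simp [Matrix.mul_apply, Matrix.one_apply]
    rw [Matrix.det_fromBlocks₁₁, hschur, zero_sub, Matrix.det_neg]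
    exact mul_ne_zero hdet (mul_ne_zero (by simp) h)
  obtain ⟨σ, hσ⟩ := exists_perm_forall_apply_ne_zero hM
  obtain ⟨he, hf⟩ := injective_of_det_submatrix_ne_zero h
  have hM₁ : ∀ u v, M (inl u) (inl v) ≠ 0 → u = v ∨ G.bi.Adj u v := fun u v h => by
    by_contra! hcon
    exact h (hΩ u v hcon.1 hcon.2)
  have hM₂ : ∀ u t, M (inl u) (inr t) ≠ 0 → f t = u ∨ G.dir (f t) u := fun u t h => by
    by_contra! hcon
    exact h (by simp [M, hcon.1.symm, hB u (f t) hcon.2])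
  have hM₃ : ∀ s x, M (inr s) x ≠ 0 → x = inl (e s) := fun s x h => by
    rcases x with u | t
    · by_contra hcon
      exact h (Matrix.one_apply_ne fun heu => hcon (congrArg inl heu.symm))
    · exact absurd rfl h
  exact exists_halfColliderSystem_of_perm he hf (fun s => hM₃ s _ (hσ _))
    (fun u v huv => hM₁ u v (huv ▸ hσ _)) fun u t hut => hM₂ u t (hut ▸ hσ _)

end Transversal

end MixedGraph

/-! ### From path systems to nonzero minors -/

theorem injective_of_subset_range_of_ncard_eq {α : Type*} {n : ℕ} {g : Fin n → α} {S : Set α}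
    (hS : S ⊆ Set.range g) (hcard : S.ncard = n) : Function.Injective g := by
  rw [← Set.injOn_univ]
  refine Set.injOn_of_ncard_image_eq (le_antisymm (Set.ncard_image_le Set.finite_univ) ?_)
    Set.finite_univ
  calc Set.univ.ncard = S.ncard := by simp [hcard]
    _ ≤ (g '' Set.univ).ncard := by
      rw [Set.image_univ]
      exact Set.ncard_le_ncard hS (Set.finite_range g)

namespace MixedGraph

section System

variable {V : Type*} {G : MixedGraph V}

theorem HalfColliderPath.exists_walk {a b : V} (p : G.HalfColliderPath a b) :
    ∃ (t : V) (q : G.bi.Walk t b), p.portion = {v | v ∈ q.support} ∧ (t ≠ a → G.dir a t) := by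
  cases p with
  | bidirected q => exact ⟨_, q, rfl, fun h => absurd rfl h⟩
  | directed h q => exact ⟨_, q, rfl, fun _ => h⟩

namespace HalfColliderSystem

variable {Sb Se : Set V} {s : ℕ} (P : G.HalfColliderSystem Sb Se s)

theorem first_injective : Function.Injective P.first :=
  injective_of_subset_range_of_ncard_eq P.exists_first P.ncard_begin

theorem last_injective : Function.Injective P.last :=
  injective_of_subset_range_of_ncard_eq P.exists_last P.ncard_end

variable {P}

theorem exists_det_submatrix_ne_zero [Fintype V] [DecidableEq V] (hP : P.DisjointPortions) :
    ∃ B Ω : Matrix V V ℝ, (∀ j k, ¬ G.dir k j → B j k = 0) ∧ Ω.PosDef ∧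
      (∀ j k, j ≠ k → ¬ G.bi.Adj j k → Ω j k = 0) ∧
      ((Ω⁻¹ * (1 - B)).submatrix P.last P.first).det ≠ 0 := by
  choose t q hportion hdir using fun l => (P.path l).exists_walk
  obtain ⟨Ω, hpos, hsupp, hdiag, hoff⟩ := exists_posDef_inv_diagonal_on_walks q fun l m hlm => by
    simpa only [hportion] using hP l m hlm
  -- The weights vanish on the paths without a directed edge, where `t n = P.first n`.
  let w : Fin s → ℝ := fun n => if t n = P.first n then 0 else 1
  let B : Matrix V V ℝ := ∑ n, Matrix.single (t n) (P.first n) (w n)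
  let d : Fin s → ℝ := fun n => Ω⁻¹ (P.last n) (t n) * w n
  have hB : ∀ j k, ¬ G.dir k j → B j k = 0 := fun j k hjk => by
    simp only [B, Matrix.sum_apply]
    refine Finset.sum_eq_zero fun n _ => ?_
    by_cases hn : t n = P.first n
    · simp [w, hn]
    · exact Matrix.single_apply_of_ne _ _ _ _ _ fun h => hjk (h.1 ▸ h.2 ▸ hdir n hn)
  have hmul : (Ω⁻¹ * B).submatrix P.last P.first = Matrix.diagonal d := by
    ext m n
    simp only [B, Matrix.mul_sum, Matrix.submatrix_apply, Matrix.sum_apply]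
    rw [Finset.sum_eq_single n (fun l _ hl => by simp [P.first_injective.ne hl.symm]) (by simp)]
    obtain rfl | hmn := eq_or_ne m n <;> simp_all [d]
  obtain ⟨c, hc⟩ := exists_det_sub_smul_diagonal_ne_zero
    (X := Ω⁻¹.submatrix P.last P.first) (d := d) fun n hn => by
      have htn : t n = P.first n := by
        by_contra h
        exact (hdiag n).ne' (by simpa [d, w, h] using hn)
      simpa only [Matrix.submatrix_apply, ← htn] using
        And.intro (hdiag n).ne' fun m hm => hoff m n hm
  refine ⟨c • B, Ω, fun j k hjk => by simp [hB j k hjk], hpos, hsupp, ?_⟩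
  have hminor : (Ω⁻¹ * (1 - c • B)).submatrix P.last P.first =
      Ω⁻¹.submatrix P.last P.first - c • Matrix.diagonal d := by
    rw [Matrix.mul_sub, Matrix.mul_one, Matrix.mul_smul, ← hmul]
    rfl
  rwa [hminor]

end HalfColliderSystem

end System

end MixedGraph

/-! ### Polynomial dependence on the free coordinates -/

section PolynomialMatrix

open MvPolynomial

/-- A matrix-valued function whose entries are polynomials in the coordinates of its argument. -/
def IsPolynomialMatrix {σ R m n : Type*} [CommRing R] (A : (σ → R) → Matrix m n R) : Prop :=
  ∃ P : Matrix m n (MvPolynomial σ R), A = fun θ => P.map (eval θ)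

namespace IsPolynomialMatrix

variable {σ R m n p q : Type*} [CommRing R] {A : (σ → R) → Matrix m n R}

theorem const (A : Matrix m n R) : IsPolynomialMatrix fun _ : σ → R => A :=
  ⟨A.map C, funext fun θ => by ext; simp⟩

theorem submatrix (hA : IsPolynomialMatrix A) (e : p → m) (f : q → n) :
    IsPolynomialMatrix fun θ => (A θ).submatrix e f := by
  obtain ⟨P, rfl⟩ := hA
  exact ⟨P.submatrix e f, rfl⟩

theorem transpose (hA : IsPolynomialMatrix A) : IsPolynomialMatrix fun θ => (A θ).transpose := by
  obtain ⟨P, rfl⟩ := hA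
  exact ⟨P.transpose, rfl⟩

theorem sub {B : (σ → R) → Matrix m n R} (hA : IsPolynomialMatrix A) (hB : IsPolynomialMatrix B) :
    IsPolynomialMatrix fun θ => A θ - B θ := by
  obtain ⟨P, rfl⟩ := hA
  obtain ⟨Q, rfl⟩ := hB
  exact ⟨P - Q, funext fun θ => (Matrix.map_sub _ (map_sub _) P Q).symm⟩

theorem mul [Fintype n] {B : (σ → R) → Matrix n p R} (hA : IsPolynomialMatrix A)
    (hB : IsPolynomialMatrix B) : IsPolynomialMatrix fun θ => A θ * B θ := by
  obtain ⟨P, rfl⟩ := hA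
  obtain ⟨Q, rfl⟩ := hB
  exact ⟨P * Q, funext fun θ => Matrix.map_mul.symm⟩

theorem fromRows {B : (σ → R) → Matrix p n R} (hA : IsPolynomialMatrix A)
    (hB : IsPolynomialMatrix B) : IsPolynomialMatrix fun θ => (A θ).fromRows (B θ) := by
  obtain ⟨P, rfl⟩ := hA
  obtain ⟨Q, rfl⟩ := hB
  exact ⟨P.fromRows Q, funext fun θ => (Matrix.fromRows_map ..).symm⟩

theorem continuous [TopologicalSpace R] [IsTopologicalSemiring R] (hA : IsPolynomialMatrix A) :
    Continuous A := by
  obtain ⟨P, rfl⟩ := hA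
  exact continuous_matrix fun j k => continuous_eval _

variable [Fintype m] [DecidableEq m] {S : (σ → R) → Matrix m m R}

theorem adjugate (hS : IsPolynomialMatrix S) : IsPolynomialMatrix fun θ => (S θ).adjugate := by
  obtain ⟨P, rfl⟩ := hS
  exact ⟨P.adjugate, funext fun θ => (RingHom.map_adjugate (eval θ) P).symm⟩

theorem exists_eval_eq_det (hS : IsPolynomialMatrix S) :
    ∃ f : MvPolynomial σ R, ∀ θ, eval θ f = (S θ).det := by
  obtain ⟨P, rfl⟩ := hS
  exact ⟨P.det, fun θ => RingHom.map_det (eval θ) P⟩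

end IsPolynomialMatrix

end PolynomialMatrix

namespace MixedGraph

namespace Coord

open Filter Topology

variable {V : Type*} {G : MixedGraph V} {N : ℕ}

theorem toB_apply_of_not_dir (θ : G.Coord N → ℝ) {j k : V} (h : ¬ G.dir k j) : toB θ j k = 0 :=
  dif_neg h

theorem toOmega_apply_of_not_adj (θ : G.Coord N → ℝ) {j k : V} (hjk : j ≠ k)
    (h : ¬ G.bi.Adj j k) : toOmega θ j k = 0 :=
  (if_neg hjk).trans (dif_neg h)

theorem isSymm_toOmega (θ : G.Coord N → ℝ) : (toOmega θ).IsSymm := by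
  ext j k
  obtain rfl | hjk := eq_or_ne j k
  · rfl
  · simp only [Matrix.transpose_apply, toOmega, Matrix.of_apply, if_neg hjk, if_neg hjk.symm,
      Sym2.eq_swap (a := k)]
    classical
    exact dite_congr (by rw [Sym2.eq_swap]) (fun _ => rfl) fun _ => rfl

theorem exists_toY_eq (θ : G.Coord N → ℝ) (Y : Matrix V (Fin N) ℝ) :
    ∃ θ' : G.Coord N → ℝ, toY θ' = Y ∧ toB θ' = toB θ ∧ toOmega θ' = toOmega θ :=
  ⟨fun c => match c with
    | .data j n => Y j n
    | c => θ c, rfl, rfl, rfl⟩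

theorem isPolynomialMatrix_toY :
    IsPolynomialMatrix (toY : (G.Coord N → ℝ) → Matrix V (Fin N) ℝ) :=
  ⟨.of fun j n => .X (.data j n), by ext; simp [toY]⟩

open Classical in
theorem isPolynomialMatrix_toB : IsPolynomialMatrix (toB : (G.Coord N → ℝ) → Matrix V V ℝ) :=
  ⟨.of fun k j => if h : G.dir j k then .X (.coeff j k h) else 0, by
    ext θ k j
    by_cases h : G.dir j k <;> simp [toB, h]⟩

open Classical in
theorem isPolynomialMatrix_toOmega :
    IsPolynomialMatrix (toOmega : (G.Coord N → ℝ) → Matrix V V ℝ) :=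
  ⟨.of fun j k => if j = k then .X (.var j) else
      if h : s(j, k) ∈ G.bi.edgeSet then .X (.cov ⟨s(j, k), h⟩) else 0, by
    ext θ j k
    by_cases hjk : j = k <;> by_cases h : G.bi.Adj j k <;> simp [toOmega, hjk, h]⟩

theorem exists_eventually_mem [Fintype V] [DecidableEq V] (G : MixedGraph V) (N : ℕ) :
    ∃ θ₁ : G.Coord N → ℝ, ∀ᶠ θ in 𝓝 θ₁, toB θ ∈ G.BSet ∧ toOmega θ ∈ G.OmegaSet := by
  let θ₁ : G.Coord N → ℝ := fun c => match c with
    | .var _ => 1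
    | _ => 0
  have hB₁ : toB θ₁ = 0 := by
    ext j k
    simp [toB, θ₁]
  have hΩ₁ : toOmega θ₁ = 1 := by
    ext j k
    simp [toOmega, θ₁, Matrix.one_apply]
  have hdet : ∀ᶠ θ in 𝓝 θ₁, (1 - toB θ).det ≠ 0 :=
    (continuous_const.sub isPolynomialMatrix_toB.continuous).matrix_det.continuousAt.eventually_ne
      (by simp [hB₁])
  have hpos : ∀ᶠ θ in 𝓝 θ₁, (toOmega θ).IsHermitian → (toOmega θ).PosDef :=
    isPolynomialMatrix_toOmega.continuous.continuousAt.eventually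
      (eventually_posDef_of_isHermitian (hΩ₁ ▸ Matrix.PosDef.one))
  refine ⟨θ₁, ?_⟩
  filter_upwards [hdet, hpos] with θ hB hΩ
  exact ⟨⟨(Matrix.isUnit_iff_isUnit_det _).2 hB.isUnit, fun j k => toB_apply_of_not_dir θ⟩,
    hΩ (Matrix.isHermitian_iff_isSymm.2 (isSymm_toOmega θ)),
    fun j k => toOmega_apply_of_not_adj θ⟩

end Coord

/-! ### The stacked matrix -/

section Deletion

variable {V : Type*}

/-- The principal submatrix of `A` on the nodes other than `i`. -/
abbrev deleteNode {R : Type*} (i : V) (A : Matrix V V R) :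
    Matrix {j : V // j ≠ i} {j : V // j ≠ i} R :=
  A.submatrix Subtype.val Subtype.val

variable (G : MixedGraph V) (i : V)

/-- The siblings of `i` as nodes of `G_{-i}`. -/
def sibNode (k : G.sib i) : {j : V // j ≠ i} := ⟨k, G.ne_of_mem_sib k.2⟩

/-- The nodes outside `pa(i) ∪ {i}` as nodes of `G_{-i}`. -/
def nonparentNode (v : ↥(G.pa i ∪ {i})ᶜ) : {j : V // j ≠ i} := ⟨v, fun h => v.2 (.inr h)⟩

theorem range_sibNode : Set.range (G.sibNode i) = {j : {j : V // j ≠ i} | (j : V) ∈ G.sib i} :=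
  Set.ext fun j => ⟨fun ⟨k, hk⟩ => hk ▸ k.2, fun hj => ⟨⟨j, hj⟩, rfl⟩⟩

theorem card_sib_sum_pa_union [Fintype (G.sib i)] [Fintype ↥(G.pa i ∪ {i})] :
    Fintype.card (G.sib i ⊕ ↥(G.pa i ∪ {i})) = (G.sib i).ncard + (G.pa i).ncard + 1 := by
  have := Set.toFinite (G.pa i ∪ {i})
  rw [Fintype.card_sum, ← Nat.card_eq_fintype_card, ← Nat.card_eq_fintype_card,
    Nat.card_coe_set_eq, Nat.card_coe_set_eq, Set.union_singleton,
    Set.ncard_insert_of_notMem (a := i) (s := G.pa i) (G.dir_irrefl i)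
      (this.subset Set.subset_union_left), add_assoc]

variable {G i}

theorem ncard_le_of_linearIndependent_row [Finite V] {n K : Type*} [Fintype n] [Field K]
    {A : Matrix (G.sib i ⊕ ↥(G.pa i ∪ {i})) n K} (hA : LinearIndependent K A.row) :
    (G.sib i).ncard + (G.pa i).ncard + 1 ≤ Fintype.card n := by
  have := Fintype.ofFinite (G.sib i)
  have := Fintype.ofFinite ↥(G.pa i ∪ {i})
  rw [← card_sib_sum_pa_union]
  exact hA.fintype_card_le_finrank.trans_eq (Module.finrank_fintype_fun_eq_card K)

theorem exists_deleteNode_eq (N : ℕ) {B Ω : Matrix {j : V // j ≠ i} {j : V // j ≠ i} ℝ}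
    (hB : ∀ j k, ¬ (G.remove i).dir k j → B j k = 0) (hsymm : Ω.IsSymm)
    (hΩ : ∀ j k, j ≠ k → ¬ (G.remove i).bi.Adj j k → Ω j k = 0) :
    ∃ θ : G.Coord N → ℝ, deleteNode i (Coord.toB θ) = B ∧ deleteNode i (Coord.toOmega θ) = Ω := by
  classical
  let extend (A : Matrix {j : V // j ≠ i} {j : V // j ≠ i} ℝ) (j k : V) : ℝ :=
    if h : j ≠ i ∧ k ≠ i then A ⟨j, h.1⟩ ⟨k, h.2⟩ else 0
  have hextend : ∀ A (j k : {j : V // j ≠ i}), extend A j k = A j k := fun A j k =>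
    dif_pos ⟨j.2, k.2⟩
  have hswap : ∀ j k, extend Ω j k = extend Ω k j := fun j k =>
    dite_congr (propext and_comm) (fun h => hsymm.apply _ _) fun _ => rfl
  let θ : G.Coord N → ℝ := fun c => match c with
    | .data _ _ => 0
    | .coeff j k _ => extend B k j
    | .var j => extend Ω j j
    | .cov e => Sym2.lift ⟨extend Ω, hswap⟩ e.1
  refine ⟨θ, ?_, ?_⟩
  · ext k j
    by_cases h : G.dir j k
    · simpa [Coord.toB, h, θ] using hextend B k j
    · simpa [Coord.toB, h] using (hB k j h).symm
  · ext j k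
    obtain rfl | hjk := eq_or_ne j k
    · simpa [Coord.toOmega, θ] using hextend Ω j j
    · have hjk' : (j : V) ≠ k := Subtype.coe_ne_coe.2 hjk
      by_cases h : G.bi.Adj j k
      · simpa [Coord.toOmega, hjk', h, θ] using hextend Ω j k
      · simpa [Coord.toOmega, hjk', h] using (hΩ j k hjk h).symm

theorem halfColliderCriterion_of_linearIndependent_row [Fintype V] [DecidableEq V]
    {B Ω : Matrix {j : V // j ≠ i} {j : V // j ≠ i} ℝ}
    (hB : ∀ j k, ¬ (G.remove i).dir k j → B j k = 0)
    (hΩ : ∀ j k, j ≠ k → ¬ (G.remove i).bi.Adj j k → Ω j k = 0) (hdet : Ω.det ≠ 0)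
    (h : LinearIndependent ℝ
      ((Ω⁻¹ * (1 - B)).submatrix (G.sibNode i) (G.nonparentNode i)).row) :
    G.HalfColliderCriterion i := by
  classical
  have := Fintype.ofFinite (G.sib i)
  have := Fintype.ofFinite ↥(G.pa i ∪ {i})ᶜ
  obtain ⟨f, hf⟩ := exists_det_submatrix_ne_zero h
  have hsystem := exists_halfColliderSystem_of_det_ne_zero hB hΩ hdet
    (e := G.sibNode i) (f := G.nonparentNode i ∘ f) hf
  rw [range_sibNode] at hsystem
  obtain ⟨P, hP⟩ := hsystem
  exact ⟨_, _, P, by rintro _ ⟨k, rfl⟩ hk; exact (f k).2 (.inl hk), hP⟩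

theorem HalfColliderCriterion.exists_linearIndependent_row [Fintype V] [DecidableEq V]
    (h : G.HalfColliderCriterion i) :
    ∃ B Ω : Matrix {j : V // j ≠ i} {j : V // j ≠ i} ℝ,
      (∀ j k, ¬ (G.remove i).dir k j → B j k = 0) ∧ Ω.PosDef ∧
      (∀ j k, j ≠ k → ¬ (G.remove i).bi.Adj j k → Ω j k = 0) ∧
      LinearIndependent ℝ
        ((Ω⁻¹ * (1 - B)).submatrix (G.sibNode i) (G.nonparentNode i)).row := by
  obtain ⟨Sb, s, P, hSb, hP⟩ := h
  obtain ⟨B, Ω, hB, hpos, hΩ, hdet⟩ := HalfColliderSystem.exists_det_submatrix_ne_zero hP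
  let sibling : Fin s → G.sib i := fun l => ⟨P.last l, P.last_mem l⟩
  have hsibling : Function.Bijective sibling := by
    refine ⟨fun l m hlm => P.last_injective (congrArg (G.sibNode i) hlm), fun k => ?_⟩
    obtain ⟨l, hl⟩ := P.exists_last (G.sibNode i k) k.2
    exact ⟨l, Subtype.ext (congrArg (Subtype.val (p := (· ≠ i))) hl)⟩
  let start : Fin s → ↥(G.pa i ∪ {i})ᶜ := fun l => ⟨P.first l, by
    rintro (h | h)
    exacts [hSb _ (P.first_mem l) h, (P.first l).2 h]⟩
  exact ⟨B, Ω, hB, hpos, hΩ, linearIndependent_row_of_det_submatrix_ne_zero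
    (.ofBijective sibling hsibling) start hdet⟩

end Deletion

section StackedCoeff

open Matrix

variable {V : Type*} [Fintype V] [DecidableEq V] {N : ℕ} {G : MixedGraph V} {i : V}

/-- The coefficients of the stacked matrix of `(A1)_i` as a linear function of `Y`, with `L` in the
role of `(Ω_{-i,-i})⁻¹`. Leaving `L` free lets the adjugate replace the inverse, so that the entries
become polynomials in the free coordinates. -/
def stackedCoeff {R : Type*} [CommRing R] (G : MixedGraph V) (i : V)
    (L : Matrix {j : V // j ≠ i} {j : V // j ≠ i} R) (B : Matrix V V R) :
    Matrix (G.sib i ⊕ ↥(G.pa i ∪ {i})) V R :=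
  fromRows (L.submatrix (G.sibNode i) id *
      (1 - B).submatrix (Subtype.val : {j : V // j ≠ i} → V) id)
    ((1 : Matrix V V R).submatrix Subtype.val id)

theorem stackedMatrix_eq_stackedCoeff_mul (Y : Matrix V (Fin N) ℝ) (B Ω : Matrix V V ℝ) :
    G.stackedMatrix i Y B Ω = G.stackedCoeff i (deleteNode i Ω)⁻¹ B * Y := by
  rw [stackedCoeff, fromRows_mul]
  ext (k | k) n
  · simp only [stackedMatrix, pseudoVariables, ← Matrix.mul_assoc]
    rfl
  · simp [stackedMatrix, Matrix.mul_apply, Matrix.one_apply]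

theorem linearIndependent_row_stackedCoeff_iff {R : Type*} [CommRing R]
    {L : Matrix {j : V // j ≠ i} {j : V // j ≠ i} R} {B : Matrix V V R} :
    LinearIndependent R (G.stackedCoeff i L B).row ↔ LinearIndependent R
      ((L * (1 - deleteNode i B)).submatrix (G.sibNode i) (G.nonparentNode i)).row := by
  have hdelete : (1 - deleteNode i B) = deleteNode i (1 - B) := by
    ext j k
    simp [Matrix.one_apply, Subtype.ext_iff]
  rw [stackedCoeff, linearIndependent_row_fromRows_one_submatrix_iff, hdelete]
  rfl

theorem linearIndependent_row_stackedCoeff_adjugate_mul_iff {K : Type*} [Field K]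
    {Y : Matrix V (Fin N) K} {B : Matrix V V K} {A : Matrix {j : V // j ≠ i} {j : V // j ≠ i} K}
    (hA : A.det ≠ 0) :
    LinearIndependent K (G.stackedCoeff i A.adjugate B * Y).row ↔
      LinearIndependent K (G.stackedCoeff i A⁻¹ B * Y).row := by
  let w : G.sib i ⊕ ↥(G.pa i ∪ {i}) → Kˣ := Sum.elim (fun _ => Units.mk0 _ hA) 1
  rw [← LinearIndependent.units_smul_iff (G.stackedCoeff i A⁻¹ B * Y).row w]
  have hadj : A.adjugate = A.det • A⁻¹ := by
    rw [Matrix.inv_def, smul_smul, Ring.mul_inverse_cancel _ hA.isUnit, one_smul]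
  have hrow : (G.stackedCoeff i A.adjugate B * Y).row =
      w • (G.stackedCoeff i A⁻¹ B * Y).row := by
    simp only [stackedCoeff, fromRows_mul, hadj, submatrix_smul, Pi.smul_apply, Matrix.smul_mul]
    ext (k | k) n
    · simp [w, Units.smul_def]
    · simp [w]
  rw [hrow]

theorem CondA1.halfColliderCriterion {Y : Matrix V (Fin N) ℝ} {B Ω : Matrix V V ℝ}
    (hB : B ∈ G.BSet) (hΩ : Ω ∈ G.OmegaSet) (h : G.CondA1 i Y B Ω) :
    G.HalfColliderCriterion i := by
  rw [CondA1, stackedMatrix_eq_stackedCoeff_mul] at h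
  exact halfColliderCriterion_of_linearIndependent_row (fun j k => hB.2 j k)
    (fun j k hjk => hΩ.2 j k (Subtype.coe_ne_coe.2 hjk))
    (hΩ.1.submatrix Subtype.val_injective).det_pos.ne'
    (linearIndependent_row_stackedCoeff_iff.1 (linearIndependent_row_of_mul h))

namespace HalfColliderCriterion

theorem exists_linearIndependent_row_stackedCoeff (h : G.HalfColliderCriterion i) (N : ℕ) :
    ∃ θ : G.Coord N → ℝ, (deleteNode i (Coord.toOmega θ)).det ≠ 0 ∧ LinearIndependent ℝ
      (G.stackedCoeff i (deleteNode i (Coord.toOmega θ))⁻¹ (Coord.toB θ)).row := by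
  obtain ⟨B, Ω, hB, hpos, hΩ, hrow⟩ := h.exists_linearIndependent_row
  obtain ⟨θ, rfl, rfl⟩ :=
    exists_deleteNode_eq N hB (Matrix.isHermitian_iff_isSymm.1 hpos.isHermitian) hΩ
  exact ⟨θ, hpos.det_pos.ne', linearIndependent_row_stackedCoeff_iff.2 hrow⟩

theorem exists_condA1 (h : G.HalfColliderCriterion i)
    (hN : (G.sib i).ncard + (G.pa i).ncard + 1 ≤ N) :
    ∃ θ : G.Coord N → ℝ, (deleteNode i (Coord.toOmega θ)).det ≠ 0 ∧
      G.CondA1 i (Coord.toY θ) (Coord.toB θ) (Coord.toOmega θ) := by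
  obtain ⟨θ, hdet, hrow⟩ := h.exists_linearIndependent_row_stackedCoeff N
  have := Fintype.ofFinite (G.sib i)
  have := Fintype.ofFinite ↥(G.pa i ∪ {i})
  obtain ⟨Y, hY⟩ := exists_linearIndependent_row_mul (p := Fin N) hrow
    (by rwa [card_sib_sum_pa_union, Fintype.card_fin])
  obtain ⟨θ', hY', hB', hΩ'⟩ := Coord.exists_toY_eq θ Y
  refine ⟨θ', hΩ' ▸ hdet, ?_⟩
  rwa [CondA1, stackedMatrix_eq_stackedCoeff_mul, hY', hB', hΩ']

end HalfColliderCriterion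

end StackedCoeff

theorem HalfColliderCriterion.ncard_sib_add_ncard_pa_add_one_le {V : Type*} [Fintype V]
    {G : MixedGraph V} {i : V} (h : G.HalfColliderCriterion i) :
    (G.sib i).ncard + (G.pa i).ncard + 1 ≤ Fintype.card V := by
  classical
  obtain ⟨θ, -, hrow⟩ := h.exists_linearIndependent_row_stackedCoeff 0
  exact ncard_le_of_linearIndependent_row hrow

/-! ### Genericity of the condition -/

section Genericity

variable {V : Type*} [Fintype V] [DecidableEq V] {N : ℕ} {G : MixedGraph V} {i : V}

open Matrix in
theorem exists_eval_ne_zero_iff_condA1 (G : MixedGraph V) (i : V) (N : ℕ) :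
    ∃ f : MvPolynomial (G.Coord N) ℝ, ∀ θ, (deleteNode i (Coord.toOmega θ)).det ≠ 0 →
      (MvPolynomial.eval θ f ≠ 0 ↔
        G.CondA1 i (Coord.toY θ) (Coord.toB θ) (Coord.toOmega θ)) := by
  classical
  have := Fintype.ofFinite (G.sib i)
  have := Fintype.ofFinite ↥(G.pa i ∪ {i})
  let S : (G.Coord N → ℝ) → Matrix (G.sib i ⊕ ↥(G.pa i ∪ {i})) (Fin N) ℝ := fun θ =>
    G.stackedCoeff i (deleteNode i (Coord.toOmega θ)).adjugate (Coord.toB θ) * Coord.toY θ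
  have hadj : IsPolynomialMatrix fun θ : G.Coord N → ℝ =>
      (deleteNode i (Coord.toOmega θ)).adjugate :=
    (Coord.isPolynomialMatrix_toOmega.submatrix _ _).adjugate
  have hB : IsPolynomialMatrix fun θ : G.Coord N → ℝ => 1 - Coord.toB θ :=
    (IsPolynomialMatrix.const 1).sub Coord.isPolynomialMatrix_toB
  have hS : IsPolynomialMatrix S :=
    (((hadj.submatrix _ _).mul (hB.submatrix _ _)).fromRows (.const _)).mul
      Coord.isPolynomialMatrix_toY
  obtain ⟨f, hf⟩ := (hS.mul hS.transpose).exists_eval_eq_det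
  refine ⟨f, fun θ hθ => ?_⟩
  rw [hf, det_mul_transpose_self_ne_zero_iff,
    linearIndependent_row_stackedCoeff_adjugate_mul_iff hθ, CondA1,
    stackedMatrix_eq_stackedCoeff_mul]

theorem holdsGenerically_condA1 {θ₀ : G.Coord N → ℝ}
    (hdet : (deleteNode i (Coord.toOmega θ₀)).det ≠ 0)
    (h : G.CondA1 i (Coord.toY θ₀) (Coord.toB θ₀) (Coord.toOmega θ₀)) :
    G.HoldsGenerically N (G.CondA1 i) := by
  obtain ⟨f, hf⟩ := exists_eval_ne_zero_iff_condA1 G i N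
  refine ⟨f, ?_, fun θ ⟨_, hΩ, hθ⟩ => ?_⟩
  · rintro rfl
    exact (hf θ₀ hdet).2 h (map_zero _)
  · by_contra hne
    exact hθ ((hf θ (hΩ.1.submatrix Subtype.val_injective).det_pos.ne').1 hne)

theorem HoldsGenerically.holdsAlmostEverywhere
    {P : Matrix V (Fin N) ℝ → Matrix V V ℝ → Matrix V V ℝ → Prop}
    (h : G.HoldsGenerically N P) : G.HoldsAlmostEverywhere N P := by
  obtain ⟨f, hf, hzero⟩ := h
  refine measure_mono_null hzero ?_
  rw [volume_pi]
  exact measure_pi_setOf_eval_eq_zero _ hf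

theorem HoldsAlmostEverywhere.exists_mem
    {P : Matrix V (Fin N) ℝ → Matrix V V ℝ → Matrix V V ℝ → Prop}
    (h : G.HoldsAlmostEverywhere N P) :
    ∃ θ : G.Coord N → ℝ, Coord.toB θ ∈ G.BSet ∧ Coord.toOmega θ ∈ G.OmegaSet ∧
      P (Coord.toY θ) (Coord.toB θ) (Coord.toOmega θ) := by
  obtain ⟨θ₁, hmem⟩ := Coord.exists_eventually_mem G N
  have hdense := Measure.dense_of_ae (measure_eq_zero_iff_ae_notMem.1 h)
  obtain ⟨θ, hθ, hB, hΩ⟩ := ((mem_closure_iff_frequently.1 (hdense θ₁)).and_eventually hmem).exists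
  exact ⟨θ, hB, hΩ, by_contra fun hP => hθ ⟨hB, hΩ, hP⟩⟩

theorem HoldsAlmostEverywhere.halfColliderCriterion
    (h : G.HoldsAlmostEverywhere N (G.CondA1 i)) :
    G.HalfColliderCriterion i ∧ (G.sib i).ncard + (G.pa i).ncard + 1 ≤ N := by
  obtain ⟨θ, hB, hΩ, hA1⟩ := h.exists_mem
  refine ⟨hA1.halfColliderCriterion hB hΩ, ?_⟩
  simpa only [Fintype.card_fin] using ncard_le_of_linearIndependent_row hA1

theorem HalfColliderCriterion.holdsGenerically (h : G.HalfColliderCriterion i)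
    (hN : (G.sib i).ncard + (G.pa i).ncard + 1 ≤ N) : G.HoldsGenerically N (G.CondA1 i) :=
  let ⟨_, hdet, hA1⟩ := h.exists_condA1 hN
  holdsGenerically_condA1 hdet hA1

end Genericity

end MixedGraph

theorem mainTheorem4_general {V : Type*} [Fintype V] [DecidableEq V] (G : MixedGraph V) (i : V)
    (N : ℕ) :
    (G.HoldsGenerically N (G.CondA1 i) ↔
        G.HalfColliderCriterion i ∧ (G.sib i).ncard + (G.pa i).ncard + 1 ≤ N) ∧
      (G.HoldsAlmostEverywhere N (G.CondA1 i) ↔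
        G.HalfColliderCriterion i ∧ (G.sib i).ncard + (G.pa i).ncard + 1 ≤ N) :=
  ⟨⟨fun h => h.holdsAlmostEverywhere.halfColliderCriterion, fun h => h.1.holdsGenerically h.2⟩,
    fun h => h.halfColliderCriterion, fun h => (h.1.holdsGenerically h.2).holdsAlmostEverywhere⟩

theorem mainTheorem4 {V : Type*} [Fintype V] [DecidableEq V] (G : MixedGraph V) (i : V)
    (N : ℕ) (hN : Fintype.card V ≤ N) :
    (G.HoldsGenerically N (G.CondA1 i) ↔ G.HalfColliderCriterion i) ∧
      (G.HoldsAlmostEverywhere N (G.CondA1 i) ↔ G.HalfColliderCriterion i) := by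
  simpa only [and_iff_left_of_imp fun h : G.HalfColliderCriterion i =>
    h.ncard_sib_add_ncard_pa_add_one_le.trans hN] using mainTheorem4_general G i N
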